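/- Let $A$ be a finite group (with the discrete topology), let $\iota$ be a finite set, and let $M$ be the free group or the free monoid on $\iota$. Let $\Gamma$ be the Cayley graph of $M$, in which $m$ is joined to $mg$ for every $m\in M$ and every free generator $g\in\iota$. Equip $A^M$ with the product topology, and let $\mu$ be a Borel probability measure on $A^M$ such that: (i) $\mu$ is stationary, that is, invariant under all shifts $\sigma^e$, $e\in M$, where $(\sigma^e x)_m = x_{em}$; (ii) $\mu$ is a Markov random field on $\Gamma$: whenever $S,U,W\subset M$ are finite and every path in $\Gamma$ from $U$ to $W$ meets $S$, the restrictions $x|_U$ and $x|_W$ of a $\mu$-random configuration $x$ are conditionally independent given $x|_S$; (iii) for every generator $g\in\iota$, all entries of the transition probability matrix $Q_g=\big(\mu(x_g=b\mid x_1=a)\big)_{a,b\in A}$ are defined and nonzero. Then $\mu$ is harmonically mixing: for every $\varepsilon>0$ there is $R>0$ such that every continuous homomorphism $\chi:A^M\to\mathbb{T}$ to the unit circle with $\operatorname{rank}(\chi)>R$ satisfies $\left|\int_{A^M}\chi\,d\mu\right|<\varepsilon$. Here $\operatorname{rank}(\chi)$ is the number of $m\in M$ for which the restriction of $\chi$ to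 the $m$-th factor of $A^M$ is a nontrivial homomorphism $A\to\mathbb{T}$. -/

import Mathlib

open MeasureTheory
open scoped ProbabilityTheory

/-- The shift `σ^e` on the configuration space `A^M`: `(σ^e x)_m = x_{e m}`. -/
def shiftMap {M A : Type*} [Mul M] (e : M) (x : M → A) : M → A :=
  fun m => x (e * m)

/-- A measure on `A^M` is stationary if it is invariant under every shift. -/
def IsShiftStationary {M A : Type*} [Mul M] [MeasurableSpace A] (μ : Measure (M → A)) : Prop :=
  ∀ e : M, MeasurePreserving (shiftMap (A := A) e) μ μ

/-- The cylinder set of all configurations which agree with `x` on the finite set `U`. -/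
def cylinderAt {M A : Type*} (U : Finset M) (x : M → A) : Set (M → A) :=
  {y | ∀ m ∈ U, y m = x m}

/-- `S` separates `U` from `V` in the graph `G`: every walk from `U` to `V` meets `S`. -/
def Separates {V : Type*} (G : SimpleGraph V) (S U W : Finset V) : Prop :=
  ∀ u ∈ U, ∀ w ∈ W, ∀ p : G.Walk u w, ∃ s ∈ S, s ∈ p.support

/-- A measure `μ` on `A^V` (`A` finite) is a Markov random field for the graph `G` on `V`
if, whenever the finite set `S` separates the finite sets `U` and `W`, the restrictions to `U`
and to `W` of a `μ`-random configuration are conditionally independent given its restriction to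
`S`. (If the conditioning event has measure zero, both sides are zero.) -/
def IsMarkovRandomField {V A : Type*} [MeasurableSpace A] (G : SimpleGraph V)
    (μ : Measure (V → A)) : Prop :=
  ∀ S U W : Finset V, Separates G S U W → ∀ x : V → A,
    μ[cylinderAt U x ∩ cylinderAt W x | cylinderAt S x] =
      μ[cylinderAt U x | cylinderAt S x] * μ[cylinderAt W x | cylinderAt S x]

/-- The transition probability matrix of a stationary measure `μ` on `A^M` in the direction of the
generator `g`: its `(a, b)` entry is the conditional probability `P(x_g = b | x_1 = a)`. -/
noncomputable def transitionMatrix {M A : Type*} [One M] [MeasurableSpace A]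
    (μ : Measure (M → A)) (g : M) : Matrix A A ENNReal :=
  Matrix.of fun a b => μ[{x | x g = b} | {x | x 1 = a}]

open Classical in
/-- The rank of a character `χ` of `A^M`: the number of coordinates `m` such that the coefficient
`χ_m : A → 𝕋`, the restriction of `χ` to the `m`-th factor, is nontrivial. -/
noncomputable def characterRank {M A : Type*} [Group A] [TopologicalSpace A]
    (χ : PontryaginDual (M → A)) : ℕ∞ :=
  {m : M | ∃ a : A, χ (Pi.mulSingle m a) ≠ 1}.encard

/-- The Fourier coefficient `⟨μ, χ⟩ = ∫ χ dμ`. -/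
noncomputable def fourierCoefficient {M A : Type*} [Group A] [TopologicalSpace A]
    [MeasurableSpace A] (μ : Measure (M → A)) (χ : PontryaginDual (M → A)) : ℂ :=
  ∫ x, (χ x : ℂ) ∂μ

/-- `μ` is harmonically mixing if its Fourier coefficients tend to zero, uniformly, as the rank of
the character tends to infinity. -/
def IsHarmonicallyMixing {M A : Type*} [Group A] [TopologicalSpace A]
    [MeasurableSpace A] (μ : Measure (M → A)) : Prop :=
  ∀ ε : ℝ, 0 < ε → ∃ R : ℕ, 0 < R ∧ ∀ χ : PontryaginDual (M → A),
    (R : ℕ∞) < characterRank χ → ‖fourierCoefficient μ χ‖ < ε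

/-! ### Cylinder events and functions of finitely many coordinates -/

section Cylinders

variable {V A : Type*}

/-! The Cayley graph is a tree, hence bipartite. If `χ` has large rank, one colour class contains a
set `J` of at least `n` nontrivial coordinates of `χ`. No two points of `J` are adjacent, so given
the values off `J` the coordinates in `J` are independent, each governed by its neighbours alone.
The integral of `χ` thus equals that of a product of local conditional expectations times a
unimodular factor (`integral_prod_apply_mul_eq`).

Each local expectation is at most some `c < 1` in norm. The conditional law of `x v` given its
neighbours gives every atom mass at least `δ`; a nontrivial character sums to zero over `A`, so the
uniform part of weight `δ` cancels (`norm_localExpectation_le`). The integral is therefore at most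
`c ^ n`.

The constant `δ` is uniform in `v`: stationarity and the nonzero transition entries bound all edge
marginals below by some `q`, and since `v` separates its neighbours these bounds multiply over a
star (`pow_le_measureReal_star`). The tree structure enters only through a parity homomorphism and a
`branch` label for the components left after deleting a vertex. -/

theorem cylinderAt_congr {U : Finset V} {x y : V → A} (h : ∀ m ∈ U, x m = y m) :
    cylinderAt U x = cylinderAt U y := by
  ext z
  exact forall₂_congr fun m hm => by rw [h m hm]

theorem self_mem_cylinderAt (U : Finset V) (x : V → A) : x ∈ cylinderAt U x := fun _ _ => rfl

theorem cylinderAt_singleton (v : V) (x : V → A) : cylinderAt {v} x = {y | y v = x v} := by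
  simp [cylinderAt]

theorem cylinderAt_union [DecidableEq V] (U W : Finset V) (x : V → A) :
    cylinderAt (U ∪ W) x = cylinderAt U x ∩ cylinderAt W x := by
  ext y
  simp only [cylinderAt, Finset.mem_union, Set.mem_ofPred_eq, Set.mem_inter_iff]
  grind

theorem cylinderAt_insert [DecidableEq V] (v : V) (W : Finset V) (x : V → A) :
    cylinderAt (insert v W) x = {y | y v = x v} ∩ cylinderAt W x := by
  rw [Finset.insert_eq, cylinderAt_union, cylinderAt_singleton]

theorem cylinderAt_update [DecidableEq V] {v : V} {W : Finset V} (hv : v ∉ W)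
    (x : V → A) (a : A) : cylinderAt W (Function.update x v a) = cylinderAt W x := by
  refine cylinderAt_congr fun m hm => Function.update_of_ne ?_ _ _
  rintro rfl
  exact hv hm

theorem cylinderAt_insert_update [DecidableEq V] {v : V} {W : Finset V} (hv : v ∉ W)
    (x : V → A) (a : A) :
    cylinderAt (insert v W) (Function.update x v a) = {y | y v = a} ∩ cylinderAt W x := by
  rw [cylinderAt_insert, Function.update_self, cylinderAt_update hv]

theorem exists_bound_of_dependsOn [Finite A] {W : Finset V} {g : (V → A) → ℂ}
    (hg : DependsOn g (W : Set V)) : ∃ C, ∀ x, ‖g x‖ ≤ C := by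
  classical
  rcases isEmpty_or_nonempty (V → A) with h | ⟨⟨x₀⟩⟩
  · exact ⟨0, fun x => h.elim x⟩
  obtain ⟨C, hC⟩ := (Set.finite_range fun p : W → A =>
    ‖g fun m => if h : m ∈ W then p ⟨m, h⟩ else x₀ m‖).bddAbove
  refine ⟨C, fun x => ?_⟩
  have : g x = g fun m => if h : m ∈ W then x m else x₀ m := by
    refine hg fun m hm => ?_
    have hm' : m ∈ W := hm
    simp [hm']
  rw [this]
  exact hC ⟨fun m => x m.1, rfl⟩

variable [MeasurableSpace A] [MeasurableSingletonClass A]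

theorem measurableSet_cylinderAt (U : Finset V) (x : V → A) : MeasurableSet (cylinderAt U x) := by
  have : cylinderAt U x = ⋂ m ∈ U, (fun y : V → A => y m) ⁻¹' {x m} := by
    ext y; simp [cylinderAt]
  rw [this]
  exact U.measurableSet_biInter fun m _ => measurable_pi_apply m (measurableSet_singleton _)

theorem measurableSet_apply_eq (v : V) (a : A) : MeasurableSet {y : V → A | y v = a} := by
  simpa only [cylinderAt_singleton] using measurableSet_cylinderAt {v} fun _ => a

/-- The Markov property cleared of denominators; if the conditioning event is null, both sides
vanish. -/
theorem IsMarkovRandomField.real_mul_real [DecidableEq V] {G : SimpleGraph V}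
    {μ : Measure (V → A)} [IsFiniteMeasure μ]
    (hμ : IsMarkovRandomField G μ) {S U W : Finset V} (hS : Separates G S U W) (x : V → A) :
    μ.real (cylinderAt (S ∪ (U ∪ W)) x) * μ.real (cylinderAt S x) =
      μ.real (cylinderAt (S ∪ U) x) * μ.real (cylinderAt (S ∪ W) x) := by
  have hm := measurableSet_cylinderAt S x
  have key := congrArg ENNReal.toReal (hμ S U W hS x)
  simp only [ProbabilityTheory.cond_apply hm, ENNReal.toReal_mul, ENNReal.toReal_inv,
    ← cylinderAt_union] at key
  simp only [← measureReal_def] at key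
  by_cases h0 : μ.real (cylinderAt S x) = 0
  · have h1 : μ.real (cylinderAt (S ∪ U) x) = 0 := by
      refine le_antisymm ?_ measureReal_nonneg
      rw [← h0, cylinderAt_union]
      exact measureReal_mono Set.inter_subset_left
    rw [h0, h1, mul_zero, zero_mul]
  · field_simp at key
    linarith

theorem aestronglyMeasurable_of_dependsOn [Finite A] {μ : Measure (V → A)} {W : Finset V}
    {g : (V → A) → ℂ}
    (hg : DependsOn g (W : Set V)) : AEStronglyMeasurable g μ := by
  classical
  rcases isEmpty_or_nonempty (V → A) with h | ⟨⟨x₀⟩⟩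
  · exact (Subsingleton.measurable (f := g)).aestronglyMeasurable
  have h : g = (fun p : W → A => g fun m => if h : m ∈ W then p ⟨m, h⟩ else x₀ m) ∘
      fun x m => x m.1 := by
    ext x
    refine hg fun m hm => ?_
    have hm' : m ∈ W := hm
    simp [hm']
  rw [h]
  exact ((measurable_of_finite fun p : W → A => g fun m => if h : m ∈ W then p ⟨m, h⟩ else x₀ m).comp
    (measurable_pi_lambda _ fun m => measurable_pi_apply m.1)).aestronglyMeasurable

theorem integrable_of_dependsOn [Finite A] {μ : Measure (V → A)} [IsFiniteMeasure μ]
    {W : Finset V} {g : (V → A) → ℂ} (hg : DependsOn g (W : Set V)) : Integrable g μ := by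
  obtain ⟨C, hC⟩ := exists_bound_of_dependsOn hg
  exact Integrable.of_bound (aestronglyMeasurable_of_dependsOn hg) C (ae_of_all _ hC)

/-- A function orthogonal to all cylinders on `W` is orthogonal to all functions of `x|_W`. -/
theorem integral_mul_eq_zero_of_dependsOn [Finite A] {μ : Measure (V → A)} [IsFiniteMeasure μ]
    {W : Finset V} {k g : (V → A) → ℂ} (hk : Integrable k μ) (hg : DependsOn g (W : Set V))
    (h0 : ∀ x, ∫ y in cylinderAt W x, k y ∂μ = 0) : ∫ x, k x * g x ∂μ = 0 := by
  classical
  rcases isEmpty_or_nonempty (V → A) with h | ⟨⟨x₀⟩⟩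
  · simp [integral_of_isEmpty]
  have := Fintype.ofFinite (W → A)
  let e : (W → A) → V → A := fun p m => if h : m ∈ W then p ⟨m, h⟩ else x₀ m
  have he : ∀ p y, y ∈ cylinderAt W (e p) ↔ p = fun m => y m.1 := by
    intro p y
    constructor
    · intro hy
      ext m
      have := hy m.1 m.2
      simpa [e] using this.symm
    · rintro rfl m hm
      simp [e, hm]
  obtain ⟨C, hC⟩ := exists_bound_of_dependsOn hg
  have hkg : Integrable (fun x => k x * g x) μ :=
    hk.mul_bdd (c := C) (aestronglyMeasurable_of_dependsOn hg) (ae_of_all _ hC)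
  have hU : (⋃ p, cylinderAt W (e p)) = Set.univ :=
    Set.eq_univ_of_forall fun y => Set.mem_iUnion.2 ⟨_, (he _ y).2 rfl⟩
  rw [← setIntegral_univ, ← hU, integral_iUnion_fintype
    (fun p => measurableSet_cylinderAt W (e p)) ?_ fun p => hkg.integrableOn]
  · refine Finset.sum_eq_zero fun p _ => ?_
    rw [setIntegral_congr_fun (measurableSet_cylinderAt W (e p))
      (g := fun y => k y * g (e p)), integral_mul_const, h0, zero_mul]
    intro y hy
    have hgy : g y = g (e p) := hg fun m hm => hy m hm
    simp only [hgy]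
  · intro p q hpq
    refine Set.disjoint_left.2 fun y hp hq => hpq ?_
    rw [(he p y).1 hp, (he q y).1 hq]

theorem integral_apply_eq_sum [Fintype A] {μ : Measure (V → A)} [IsFiniteMeasure μ]
    (v : V) (φ : A → ℂ) :
    ∫ x, φ (x v) ∂μ = ∑ a, φ a * (μ.real {x | x v = a} : ℂ) := by
  have hm : Measurable fun x : V → A => x v := measurable_pi_apply v
  rw [← integral_map (f := φ) hm.aemeasurable (measurable_of_finite φ).aestronglyMeasurable,
    integral_fintype Integrable.of_finite]
  refine Finset.sum_congr rfl fun a _ => ?_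
  rw [map_measureReal_apply hm (measurableSet_singleton a), Complex.real_smul, mul_comm]
  rfl

end Cylinders

/-! ### Replacing coordinates by their local conditional expectations -/

section ConditionalExpectation

variable {V A : Type*} [MeasurableSpace A]

/-- The conditional expectation of `φ (x v)` given the restriction of `x` to the finite set `N`. -/
noncomputable def localExpectation [Fintype A] (μ : Measure (V → A)) (v : V) (N : Finset V)
    (φ : A → ℂ) (x : V → A) : ℂ :=
  ∑ a, φ a * ((μ.real ({y | y v = a} ∩ cylinderAt N x) / μ.real (cylinderAt N x) : ℝ) : ℂ)

theorem dependsOn_localExpectation [Fintype A] (μ : Measure (V → A)) (v : V) (N : Finset V)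
    (φ : A → ℂ) : DependsOn (localExpectation μ v N φ) (N : Set V) := by
  intro x y h
  simp only [localExpectation, cylinderAt_congr h]

variable [MeasurableSingletonClass A] [Fintype A] {G : SimpleGraph V} {μ : Measure (V → A)}

/-- On each cylinder over `W`, the Markov property says that conditioning `x v` on `W` is the same
as conditioning on `N`. -/
theorem integral_apply_mul_eq [IsFiniteMeasure μ]
    (hμ : IsMarkovRandomField G μ) {v : V} {N W : Finset V} (hN : Separates G N {v} W)
    (hNW : N ⊆ W) (hv : v ∉ W) (φ : A → ℂ) {g : (V → A) → ℂ} (hg : DependsOn g (W : Set V)) :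
    ∫ x, φ (x v) * g x ∂μ = ∫ x, localExpectation μ v N φ x * g x ∂μ := by
  classical
  have hφ : DependsOn (fun x : V → A => φ (x v)) (({v} : Finset V) : Set V) := by
    intro x y h
    simp only [h v (by simp)]
  have hvN : v ∉ N := fun h => hv (hNW h)
  have i1 : Integrable (fun x : V → A => φ (x v)) μ := integrable_of_dependsOn hφ
  have i2 : Integrable (localExpectation μ v N φ) μ :=
    integrable_of_dependsOn (dependsOn_localExpectation μ v N φ)
  have hg' := exists_bound_of_dependsOn hg
  obtain ⟨C, hC⟩ := hg'
  have hgm : AEStronglyMeasurable g μ := aestronglyMeasurable_of_dependsOn hg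
  have key := integral_mul_eq_zero_of_dependsOn (i1.sub i2) hg ?_
  · simp only [Pi.sub_apply, sub_mul] at key
    rwa [integral_sub (i1.mul_bdd (c := C) hgm (ae_of_all _ hC))
      (i2.mul_bdd (c := C) hgm (ae_of_all _ hC)), sub_eq_zero] at key
  · intro x
    simp only [Pi.sub_apply]
    rw [integral_sub i1.integrableOn i2.integrableOn, integral_apply_eq_sum, sub_eq_zero,
      setIntegral_congr_fun (measurableSet_cylinderAt W x)
        (g := fun _ => localExpectation μ v N φ x)
        (fun y hy => dependsOn_localExpectation μ v N φ fun m hm => hy m (hNW hm)),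
      setIntegral_const, localExpectation, Complex.real_smul, Finset.mul_sum]
    refine Finset.sum_congr rfl fun a _ => ?_
    rw [measureReal_restrict_apply (measurableSet_apply_eq v a)]
    -- As `v` lies outside `W` and `N`, the update prescribes the value `a` at `v` and leaves the
    -- other cylinders alone.
    have h := hμ.real_mul_real hN (Function.update x v a)
    have e1 : N ∪ ({v} ∪ W) = insert v W := by
      ext m; simp only [Finset.mem_union, Finset.mem_singleton, Finset.mem_insert]; grind
    have e2 : N ∪ {v} = insert v N := by
      ext m; simp only [Finset.mem_union, Finset.mem_singleton, Finset.mem_insert]; grind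
    rw [e1, e2, Finset.union_eq_right.2 hNW, cylinderAt_insert_update hv,
      cylinderAt_insert_update hvN,
      cylinderAt_update hvN, cylinderAt_update hv] at h
    have h2 : μ.real ({y | y v = a} ∩ cylinderAt W x) =
        μ.real (cylinderAt W x) *
          (μ.real ({y | y v = a} ∩ cylinderAt N x) / μ.real (cylinderAt N x)) := by
      by_cases h0 : μ.real (cylinderAt N x) = 0
      · rw [h0, div_zero, mul_zero]
        refine le_antisymm ?_ measureReal_nonneg
        rw [← h0]
        exact measureReal_mono fun y hy m hm => hy.2 m (hNW hm)
      · field_simp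
        linarith
    rw [h2]
    push_cast
    ring

/-- Sites of `J` are replaced one at a time. Those still untouched count as part of the conditioning
set; a replaced factor depends only on `N v ⊆ W` and is absorbed into `g`. -/
theorem integral_prod_apply_mul_eq [IsFiniteMeasure μ]
    (hμ : IsMarkovRandomField G μ) {N : V → Finset V}
    (hN : ∀ (v : V) (W : Finset V), v ∉ W → Separates G (N v) {v} W)
    {W J : Finset V} (hNW : ∀ v ∈ J, N v ⊆ W) (hJ : Disjoint J W) (φ : V → A → ℂ)
    {g : (V → A) → ℂ} (hg : DependsOn g (W : Set V)) :
    ∫ x, (∏ v ∈ J, φ v (x v)) * g x ∂μ =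
      ∫ x, (∏ v ∈ J, localExpectation μ v (N v) (φ v) x) * g x ∂μ := by
  classical
  induction J using Finset.induction_on generalizing g with
  | empty => simp
  | insert v J hvJ ih =>
    rw [Finset.disjoint_insert_left] at hJ
    simp only [Finset.prod_insert hvJ, mul_assoc]
    have hvW : v ∉ J ∪ W := by simp [hvJ, hJ.1]
    rw [integral_apply_mul_eq hμ (hN v _ hvW)
      ((hNW v (by simp)).trans Finset.subset_union_right) hvW]
    · have hg' : DependsOn (fun x => localExpectation μ v (N v) (φ v) x * g x) (W : Set V) := by
        intro x y h
        have e1 : localExpectation μ v (N v) (φ v) x = localExpectation μ v (N v) (φ v) y :=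
          dependsOn_localExpectation μ v (N v) (φ v) fun m hm => h m (hNW v (by simp) hm)
        simp only [hg h, e1]
      have := ih (fun u hu => hNW u (Finset.mem_insert_of_mem hu)) hJ.2 hg'
      calc _ = _ := integral_congr_ae (ae_of_all _ fun x => by ring)
        _ = _ := this
        _ = _ := integral_congr_ae (ae_of_all _ fun x => by ring)
    · intro x y h
      have e1 : ∏ u ∈ J, φ u (x u) = ∏ u ∈ J, φ u (y u) :=
        Finset.prod_congr rfl fun u hu => by rw [h u (by simp [hu])]
      have e2 : g x = g y := hg fun m hm => h m (by
        have : m ∈ W := hm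
        simp [this])
      simp only [e1, e2]

end ConditionalExpectation

/-! ### Lower bounds on stars and contraction of local expectations -/

section Bounds

variable {V A : Type*} [MeasurableSpace A] [MeasurableSingletonClass A]
  {G : SimpleGraph V} {μ : Measure (V → A)} [IsProbabilityMeasure μ]

/-- Given `x v`, the neighbours are independent because `v` separates them, so each new neighbour
costs one factor `q`; the division by the marginal at `v` only helps. The extra factor is for `v`
itself. -/
theorem pow_le_measureReal_star [DecidableEq V] (hμ : IsMarkovRandomField G μ) {v : V}
    {q : ℝ} (hq : 0 ≤ q) (hq1 : ∀ a, q ≤ μ.real {x | x v = a})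
    (hq2 : ∀ u, G.Adj v u → ∀ a b, q ≤ μ.real {x | x v = a ∧ x u = b})
    {N : Finset V} (hN : ∀ u ∈ N, G.Adj v u)
    (hsep : ∀ u ∈ N, ∀ w ∈ N, u ≠ w → ∀ p : G.Walk u w, v ∈ p.support) (x : V → A) :
    q ^ (N.card + 1) ≤ μ.real (cylinderAt (insert v N) x) := by
  induction N using Finset.induction_on with
  | empty =>
    simpa [cylinderAt_singleton] using hq1 (x v)
  | insert u N hu ih =>
    have ih := ih (fun w hw => hN w (by simp [hw]))
      fun w hw w' hw' => hsep w (by simp [hw]) w' (by simp [hw'])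
    have hS : Separates G {v} {u} N := by
      intro u' hu' w hw p
      rw [Finset.mem_singleton] at hu'
      subst hu'
      exact ⟨v, by simp, hsep u' (by simp) w (by simp [hw]) (fun h => hu (h ▸ hw)) p⟩
    have h := hμ.real_mul_real hS x
    have e1 : ({v} : Finset V) ∪ ({u} ∪ N) = insert v (insert u N) := rfl
    have e2 : ({v} : Finset V) ∪ N = insert v N := rfl
    rw [e1, e2] at h
    have hvu : q ≤ μ.real (cylinderAt ({v} ∪ {u}) x) := by
      rw [cylinderAt_union, cylinderAt_singleton, cylinderAt_singleton]
      exact hq2 u (hN u (by simp)) _ _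
    rw [Finset.card_insert_of_notMem hu]
    calc q ^ (N.card + 1 + 1) = q * q ^ (N.card + 1) := by ring
      _ ≤ μ.real (cylinderAt ({v} ∪ {u}) x) * μ.real (cylinderAt (insert v N) x) := by
        gcongr
      _ = _ := h.symm
      _ ≤ μ.real (cylinderAt (insert v (insert u N)) x) * 1 := by
        gcongr
        exact measureReal_le_one
      _ = _ := mul_one _

/-- Subtracting `δ` from every conditional weight changes nothing because `φ` sums to zero; the
remaining weights are nonnegative with total `1 - |A| δ`. -/
theorem norm_localExpectation_le [Fintype A] [DecidableEq V] {v : V} {N : Finset V} (hv : v ∉ N)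
    {δ : ℝ} (hδ : 0 < δ) (h : ∀ x, δ ≤ μ.real (cylinderAt (insert v N) x)) {φ : A → ℂ}
    (hφ : ∀ a, ‖φ a‖ ≤ 1) (hφ0 : ∑ a, φ a = 0) (x : V → A) :
    ‖localExpectation μ v N φ x‖ ≤ 1 - Fintype.card A * δ := by
  set P := μ.real (cylinderAt N x) with hP
  set w : A → ℝ := fun a => μ.real ({y | y v = a} ∩ cylinderAt N x) / P with hw
  have hsum : ∑ a, μ.real ({y | y v = a} ∩ cylinderAt N x) = P := by
    rw [← measureReal_iUnion_fintype, ← Set.iUnion_inter]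
    · congr 2
      ext y
      simp
    · intro a b hab
      refine Set.disjoint_left.2 fun y ha hb => hab ?_
      exact ha.1.symm.trans hb.1
    · exact fun a => (measurableSet_apply_eq v a).inter (measurableSet_cylinderAt N x)
  have hPpos : 0 < P := by
    refine hδ.trans_le ((h x).trans ?_)
    rw [cylinderAt_insert]
    exact measureReal_mono Set.inter_subset_right
  have hP1 : P ≤ 1 := measureReal_le_one
  have hwδ : ∀ a, δ ≤ w a := by
    intro a
    have := h (Function.update x v a)
    rw [cylinderAt_insert_update hv] at this
    refine this.trans ?_
    rw [hw, le_div_iff₀ hPpos]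
    exact mul_le_of_le_one_right measureReal_nonneg hP1
  have hw1 : ∑ a, w a = 1 := by
    rw [hw, ← Finset.sum_div, hsum, div_self hPpos.ne']
  have e : localExpectation μ v N φ x = ∑ a, φ a * ((w a - δ : ℝ) : ℂ) := by
    simp only [Complex.ofReal_sub, mul_sub, Finset.sum_sub_distrib, ← Finset.sum_mul, hφ0,
      zero_mul, sub_zero]
    rfl
  rw [e]
  calc _ ≤ ∑ a, ‖φ a * ((w a - δ : ℝ) : ℂ)‖ := norm_sum_le _ _
    _ ≤ ∑ a, (w a - δ) := by
      refine Finset.sum_le_sum fun a _ => ?_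
      rw [norm_mul, Complex.norm_real, Real.norm_of_nonneg (sub_nonneg.2 (hwδ a))]
      exact mul_le_of_le_one_left (sub_nonneg.2 (hwδ a)) (hφ a)
    _ = _ := by simp [Finset.sum_sub_distrib, hw1]

end Bounds

/-! ### Characters of the product group and the general mixing criterion -/

section Characters

variable {V A : Type*} [Group A] [TopologicalSpace A]

/-- The values of `χ` are roots of unity of order dividing `|A|`, a finite set, so `χ` is
identically `1` on some basic neighbourhood of the identity. -/
theorem exists_finset_forall_eq_one [Finite A] [DiscreteTopology A]
    (χ : PontryaginDual (V → A)) :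
    ∃ F : Finset V, ∀ x : V → A, (∀ m ∈ F, x m = 1) → χ x = 1 := by
  have hroots : {z : Circle | z ^ Nat.card A = 1}.Finite := by
    have h : {z : ℂ | z ^ Nat.card A = 1}.Finite := by
      refine ((Polynomial.nthRootsFinset (Nat.card A) (1 : ℂ)).finite_toSet).subset fun z hz => ?_
      exact (Polynomial.mem_nthRootsFinset Nat.card_pos (1 : ℂ)).2 hz
    refine Set.Finite.of_finite_image (f := ((↑) : Circle → ℂ)) (h.subset ?_)
      Circle.coe_injective.injOn
    rintro _ ⟨z, hz, rfl⟩
    have : z ^ Nat.card A = 1 := hz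
    change (z : ℂ) ^ Nat.card A = 1
    rw [← Circle.coe_pow, this, Circle.coe_one]
  have hpow : ∀ x : V → A, χ x ^ Nat.card A = 1 := by
    intro x
    rw [← map_pow]
    have : x ^ Nat.card A = 1 := by
      ext m
      simp
    rw [this, map_one]
  have hopen : IsOpen (χ ⁻¹' ({z : Circle | z ^ Nat.card A = 1} \ {1})ᶜ) :=
    (hroots.subset Set.sdiff_subset).isClosed.isOpen_compl.preimage χ.continuous_toFun
  have h1 : (1 : V → A) ∈ χ ⁻¹' ({z : Circle | z ^ Nat.card A = 1} \ {1})ᶜ := by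
    simp
  obtain ⟨F, u, hu, hsub⟩ := isOpen_pi_iff.1 hopen 1 h1
  refine ⟨F, fun x hx => ?_⟩
  have := hsub (a := x) fun m hm => by
    rw [hx m hm]
    exact (hu m hm).2
  by_contra hne
  exact this ⟨hpow x, hne⟩

theorem apply_eq_prod_mulSingle [DecidableEq V] (χ : PontryaginDual (V → A)) {F : Finset V}
    (hF : ∀ x : V → A, (∀ m ∈ F, x m = 1) → χ x = 1) (x : V → A) :
    χ x = ∏ m ∈ F, χ (Pi.mulSingle m (x m)) := by
  have key : ∀ (T : Finset V) (y : V → A), (∀ m ∉ T, y m = 1) →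
      χ y = ∏ m ∈ T, χ (Pi.mulSingle m (y m)) := by
    intro T
    induction T using Finset.induction_on with
    | empty =>
      intro y hy
      have : y = 1 := funext fun m => hy m (by simp)
      simp [this]
    | insert v T hv ih =>
      intro y hy
      have e : y = Pi.mulSingle v (y v) * Function.update y v 1 := by
        ext m
        by_cases h : m = v
        · subst h; simp
        · simp [h]
      have h1 : χ y = χ (Pi.mulSingle v (y v)) * χ (Function.update y v 1) := by
        rw [← map_mul, ← e]
      rw [Finset.prod_insert hv, h1, ih (Function.update y v 1)]
      · congr 1
        refine Finset.prod_congr rfl fun m hm => ?_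
        rw [Function.update_of_ne fun h : m = v => hv (h ▸ hm)]
      · intro m hm
        by_cases h : m = v
        · subst h; simp
        · rw [Function.update_of_ne h]
          exact hy m (by simp [h, hm])
  have e : x = (F.piecewise x 1) * ((F.piecewise x 1)⁻¹ * x) := by simp
  have h1 : χ ((F.piecewise x 1)⁻¹ * x) = 1 := hF _ fun m hm => by simp [hm]
  calc χ x = χ (F.piecewise x 1) := by
        rw [e, map_mul, h1, mul_one, ← e]
    _ = ∏ m ∈ F, χ (Pi.mulSingle m (F.piecewise x 1 m)) := key F _ fun m hm => by simp [hm]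
    _ = _ := Finset.prod_congr rfl fun m hm => by simp [hm]

theorem sum_mulSingle_eq_zero [Fintype A] [DecidableEq V] (χ : PontryaginDual (V → A)) {v : V}
    (hv : ∃ a : A, χ (Pi.mulSingle v a) ≠ 1) : ∑ a : A, (χ (Pi.mulSingle v a) : ℂ) = 0 := by
  obtain ⟨a, ha⟩ := hv
  let f : A →* ℂ :=
    { toFun := fun a => (χ (Pi.mulSingle v a) : ℂ)
      map_one' := by simp
      map_mul' := fun a b => by simp [Pi.mulSingle_mul] }
  refine sum_hom_units_eq_zero f fun h => ha ?_
  have : f a = 1 := by rw [h]; rfl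
  exact Circle.coe_injective (this.trans Circle.coe_one.symm)

/-- A Markov random field on a graph of bounded degree with a proper 2-colouring, in which any two
neighbours of a vertex are separated by it, is harmonically mixing as soon as the one- and two-point
marginals along vertices and edges are bounded below. -/
theorem IsMarkovRandomField.isHarmonicallyMixing [Finite A] [DiscreteTopology A]
    [MeasurableSpace A] [BorelSpace A] {G : SimpleGraph V} {μ : Measure (V → A)}
    [IsProbabilityMeasure μ] (hμ : IsMarkovRandomField G μ) {N : V → Finset V}
    (hN : ∀ v u, u ∈ N v ↔ G.Adj v u) {D : ℕ} (hD : ∀ v, (N v).card ≤ D) (C : G.Coloring Bool)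
    (hsep : ∀ v u w, G.Adj v u → G.Adj v w → u ≠ w → ∀ p : G.Walk u w, v ∈ p.support)
    {q : ℝ} (hq : 0 < q) (hq1 : ∀ v a, q ≤ μ.real {x | x v = a})
    (hq2 : ∀ v u, G.Adj v u → ∀ a b, q ≤ μ.real {x | x v = a ∧ x u = b}) :
    IsHarmonicallyMixing μ := by
  classical
  have := Fintype.ofFinite A
  set δ := q ^ (D + 1) with hδ
  have hδ0 : 0 < δ := pow_pos hq _
  -- Truncating at zero makes powers of `c` monotone without checking that `|A| δ ≤ 1`.
  set c : ℝ := max (1 - Fintype.card A * δ) 0 with hc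
  have hc0 : 0 ≤ c := le_max_right _ _
  have hc1 : c < 1 := by
    have : (0 : ℝ) < Fintype.card A := by exact_mod_cast Fintype.card_pos
    refine max_lt ?_ one_pos
    linarith [mul_pos this hδ0]
  have hvN : ∀ v, v ∉ N v := fun v h => G.loopless.irrefl v ((hN v v).1 h)
  have hstar : ∀ v x, δ ≤ μ.real (cylinderAt (insert v (N v)) x) := by
    intro v x
    have hq_le : q ≤ 1 := (hq1 v 1).trans measureReal_le_one
    refine le_trans (pow_le_pow_of_le_one hq.le hq_le (Nat.succ_le_succ (hD v))) ?_
    exact pow_le_measureReal_star hμ hq.le (hq1 v) (hq2 v) (fun u hu => (hN v u).1 hu)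
      (fun u hu w hw => hsep v u w ((hN v u).1 hu) ((hN v w).1 hw)) x
  have hNsep : ∀ (v : V) (W : Finset V), v ∉ W → Separates G (N v) {v} W := by
    intro v W hv u hu w hw p
    rw [Finset.mem_singleton] at hu
    subst hu
    cases p with
    | nil => exact absurd hw hv
    | cons h p => exact ⟨_, (hN _ _).2 h, by simp⟩
  intro ε hε
  obtain ⟨n, hn⟩ := exists_pow_lt_of_lt_one hε hc1
  -- By pigeonhole one of the two colours gets at least `n` nontrivial coordinates; the `+ 1` keeps
  -- `R` positive when `n = 0`.
  refine ⟨2 * n + 1, by omega, fun χ hχ => ?_⟩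
  obtain ⟨F, hF⟩ := exists_finset_forall_eq_one χ
  have hprod := apply_eq_prod_mulSingle χ hF
  set S : Finset V := F.filter fun m => ∃ a : A, χ (Pi.mulSingle m a) ≠ 1 with hS
  have hrank : characterRank χ = S.card := by
    rw [characterRank, ← Set.encard_coe_eq_coe_finsetCard]
    congr 1
    ext m
    simp only [hS, Finset.coe_filter, Set.mem_ofPred_eq]
    constructor
    · rintro ⟨a, ha⟩
      refine ⟨?_, a, by convert ha⟩
      by_contra hm
      refine ha (hF _ fun k hk => Pi.mulSingle_eq_of_ne ?_ _)
      rintro rfl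
      exact hm hk
    · rintro ⟨-, a, ha⟩
      exact ⟨a, by convert ha⟩
  have hcard : 2 * n + 1 < S.card := by
    rw [hrank] at hχ
    exact_mod_cast hχ
  obtain ⟨b, hb⟩ : ∃ b, n ≤ (S.filter fun m => C m = b).card := by
    by_contra! h
    have h1 := h true
    have h2 := h false
    have := Finset.card_filter_add_card_filter_not (s := S) (fun m => C m = true)
    simp only [Bool.not_eq_true] at this
    omega
  set J := S.filter fun m => C m = b with hJ
  have hJF : J ⊆ F := (Finset.filter_subset _ _).trans (Finset.filter_subset _ _)
  -- The conditioning set: the rest of the support and all neighbours of `J`. It misses `J` because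
  -- the colouring is proper.
  set W := (F \ J) ∪ J.biUnion N with hW
  have hJW : Disjoint J W := by
    refine Finset.disjoint_union_right.2 ⟨Finset.disjoint_sdiff, ?_⟩
    rw [Finset.disjoint_left]
    intro u hu hu'
    obtain ⟨v, hv, huv⟩ := Finset.mem_biUnion.1 hu'
    refine C.valid ((hN v u).1 huv) ?_
    rw [(Finset.mem_filter.1 hu).2, (Finset.mem_filter.1 hv).2]
  let φ : V → A → ℂ := fun m a => (χ (Pi.mulSingle m a) : ℂ)
  let g : (V → A) → ℂ := fun x => ∏ m ∈ F \ J, φ m (x m)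
  have hg : DependsOn g (W : Set V) := by
    intro x y h
    refine Finset.prod_congr rfl fun m hm => ?_
    rw [h m (by simp only [hW, Finset.coe_union, Set.mem_union, Finset.mem_coe]; exact .inl hm)]
  have hχφ : ∀ x, (χ x : ℂ) = (∏ m ∈ J, φ m (x m)) * g x := by
    intro x
    rw [hprod x, mul_comm, Finset.prod_sdiff hJF]
    exact map_prod Circle.coeHom _ _
  have hφ1 : ∀ m a, ‖φ m a‖ = 1 := fun m a => Circle.norm_coe _
  have hNW : ∀ v ∈ J, N v ⊆ W := fun v hv =>
    (Finset.subset_biUnion_of_mem N hv).trans Finset.subset_union_right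
  have hloc : ∀ v ∈ J, ∀ x, ‖localExpectation μ v (N v) (φ v) x‖ ≤ c := fun v hv x =>
    (norm_localExpectation_le (hvN v) hδ0 (hstar v) (fun a => (hφ1 v a).le)
      (sum_mulSingle_eq_zero χ (Finset.mem_filter.1 (Finset.mem_filter.1 hv).1).2) x).trans
      (le_max_left _ _)
  rw [fourierCoefficient]
  simp only [hχφ]
  rw [integral_prod_apply_mul_eq hμ hNsep hNW hJW φ hg]
  refine lt_of_le_of_lt ?_ hn
  have := norm_integral_le_of_norm_le_const (μ := μ) (C := c ^ n)
    (f := fun x => (∏ v ∈ J, localExpectation μ v (N v) (φ v) x) * g x) (ae_of_all _ fun x => ?_)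
  · simpa using this
  · have hgx : ‖g x‖ = 1 := by simp [g, norm_prod, hφ1]
    rw [norm_mul, hgx, mul_one, norm_prod]
    calc _ ≤ ∏ _v ∈ J, c :=
          Finset.prod_le_prod (fun _ _ => norm_nonneg _) fun v hv => hloc v hv x
      _ = c ^ J.card := by simp
      _ ≤ c ^ n := pow_le_pow_of_le_one hc0 hc1.le hb

end Characters

/-! ### Cayley graphs with parity and branch functions -/

section CayleyGraph

variable {M A ι : Type*}

/-- A certificate of separation: vertices with different labels cannot be joined while avoiding `v`.
-/
theorem SimpleGraph.Walk.apply_eq_of_notMem_support {V β : Type*} {G : SimpleGraph V} {v : V}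
    {f : V → β} (hf : ∀ x y, G.Adj x y → x ≠ v → y ≠ v → f x = f y) {u w : V} (p : G.Walk u w)
    (hp : v ∉ p.support) : f u = f w := by
  induction p with
  | nil => rfl
  | cons h p ih =>
    rw [SimpleGraph.Walk.support_cons, List.mem_cons, not_or] at hp
    rw [hf _ _ h (Ne.symm hp.1) ?_, ih hp.2]
    rintro rfl
    exact hp.2 p.start_mem_support

/-- A stationary Markov random field on the Cayley graph of a right cancellative monoid with respect
to finitely many generators is harmonically mixing, provided that the Cayley graph has vertex
separators (encoded by branch functions), that there is a parity on the monoid, and that its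
transition matrices have no zero entry. -/
theorem isHarmonicallyMixing_of_mulCayley [Group A] [Finite A] [TopologicalSpace A]
    [DiscreteTopology A] [MeasurableSpace A] [BorelSpace A] [Monoid M] [IsRightCancelMul M]
    [Finite ι] [Nonempty ι] {γ : ι → M} {μ : Measure (M → A)}
    [IsProbabilityMeasure μ] (hst : IsShiftStationary μ)
    (hμ : IsMarkovRandomField (SimpleGraph.mulCayley (Set.range γ)) μ)
    (hpos : ∀ i a b, transitionMatrix μ (γ i) a b ≠ 0)
    (parity : M →* Multiplicative (ZMod 2)) (hpar : ∀ i, parity (γ i) = Multiplicative.ofAdd 1)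
    {β : Type*} (branch : M → M → β)
    (hbranch : ∀ v x i, x ≠ v → x * γ i ≠ v → branch v x = branch v (x * γ i))
    (hinj : ∀ v, Set.InjOn (branch v)
      {u | (SimpleGraph.mulCayley (Set.range γ)).Adj v u}) :
    IsHarmonicallyMixing μ := by
  classical
  set G := SimpleGraph.mulCayley (Set.range γ) with hG
  have hadj : ∀ u v, G.Adj u v ↔ u ≠ v ∧ ∃ i, u * γ i = v ∨ u = v * γ i := by
    intro u v
    rw [hG, SimpleGraph.mulCayley_adj', Set.exists_range_iff]
  have := Fintype.ofFinite ι
  -- the neighbours of a vertex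
  have hfin : ∀ v, ∃ N : Finset M, (∀ u, u ∈ N ↔ G.Adj v u) ∧
      N.card ≤ Fintype.card ι + Fintype.card ι := by
    intro v
    -- By right cancellation `v` has at most one predecessor per generator, so the chosen one is the
    -- only one.
    let T : Finset M := Finset.univ.image (fun i => v * γ i) ∪
      Finset.univ.biUnion fun i => if h : ∃ u, v = u * γ i then {h.choose} else ∅
    have hT : T.card ≤ Fintype.card ι + Fintype.card ι := by
      refine (Finset.card_union_le _ _).trans (Nat.add_le_add Finset.card_image_le ?_)
      refine Finset.card_biUnion_le.trans ?_
      calc _ ≤ ∑ _i : ι, 1 := Finset.sum_le_sum fun i _ => by split <;> simp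
        _ = _ := by simp
    refine ⟨T.filter fun u => G.Adj v u, fun u => ?_, (Finset.card_filter_le _ _).trans hT⟩
    rw [Finset.mem_filter, and_iff_right_iff_imp]
    intro h
    obtain ⟨-, i, hi | hi⟩ := (hadj v u).1 h
    · exact Finset.mem_union_left _ (Finset.mem_image.2 ⟨i, Finset.mem_univ _, hi⟩)
    · refine Finset.mem_union_right _ (Finset.mem_biUnion.2 ⟨i, Finset.mem_univ _, ?_⟩)
      have hex : ∃ u, v = u * γ i := ⟨u, hi⟩
      rw [dif_pos hex, Finset.mem_singleton]
      exact mul_right_cancel (hi.symm.trans hex.choose_spec)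
  choose N hN hD using hfin
  have hne : ∀ i u, parity (u * γ i) ≠ parity u := by
    intro i u h
    rw [map_mul, hpar, mul_eq_left] at h
    exact absurd h (by decide)
  let e : Multiplicative (ZMod 2) → Bool := fun z => decide (z = 1)
  have he : Function.Injective e := by decide
  let C : G.Coloring Bool := SimpleGraph.Coloring.mk (fun m => e (parity m)) (by
    intro u v h
    obtain ⟨-, i, rfl | rfl⟩ := (hadj u v).1 h
    · exact fun h => hne i u (he h).symm
    · exact fun h => hne i v (he h))
  have hbr : ∀ v x y, G.Adj x y → x ≠ v → y ≠ v → branch v x = branch v y := by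
    intro v x y h hx hy
    obtain ⟨-, i, rfl | rfl⟩ := (hadj x y).1 h
    · exact hbranch v x i hx hy
    · exact (hbranch v y i hy hx).symm
  have hsep : ∀ v u w, G.Adj v u → G.Adj v w → u ≠ w → ∀ p : G.Walk u w, v ∈ p.support := by
    intro v u w hu hw huw p
    by_contra hp
    exact huw (hinj v hu hw (p.apply_eq_of_notMem_support (hbr v) hp))
  -- uniform lower bounds
  have hpair0 : ∀ i a b, 0 < μ.real {x | x 1 = a ∧ x (γ i) = b} := by
    intro i a b
    have h := hpos i a b
    rw [transitionMatrix, Matrix.of_apply,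
      ProbabilityTheory.cond_apply (measurableSet_apply_eq 1 a)] at h
    exact ENNReal.toReal_pos (right_ne_zero_of_mul h) (measure_ne_top _ _)
  obtain ⟨t, ht⟩ := Finite.exists_min
    fun t : ι × A × A => μ.real {x | x 1 = t.2.1 ∧ x (γ t.1) = t.2.2}
  set q := μ.real {x | x 1 = t.2.1 ∧ x (γ t.1) = t.2.2} with hq
  -- The shift by `v` pulls events on the edge from `1` to `γ i` back to the edge from `v` to `v * γ
  -- i`; no inverse of `v` is needed.
  have hpair : ∀ v i a b, q ≤ μ.real {x | x v = a ∧ x (v * γ i) = b} := by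
    intro v i a b
    refine (ht (i, a, b)).trans_eq ?_
    have hm : MeasurableSet {x : M → A | x 1 = a ∧ x (γ i) = b} :=
      (measurableSet_apply_eq 1 a).inter (measurableSet_apply_eq (γ i) b)
    rw [← (hst v).measureReal_preimage hm.nullMeasurableSet]
    simp [shiftMap, Set.preimage]
  refine hμ.isHarmonicallyMixing hN hD C hsep (hpair0 _ _ _ : 0 < q) ?_ ?_
  · intro v a
    obtain ⟨i⟩ := ‹Nonempty ι›
    exact (hpair v i a 1).trans (measureReal_mono fun x hx => hx.1)
  · intro v u h a b
    obtain ⟨-, i, rfl | rfl⟩ := (hadj v u).1 h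
    · exact hpair v i a b
    · refine (hpair u i b a).trans_eq ?_
      simp only [and_comm]

/-- Covers the case without generators, where the transition hypothesis is empty: ranks are at most
one, so `R = 1` works vacuously. -/
theorem isHarmonicallyMixing_of_subsingleton [Subsingleton M] [Group A] [TopologicalSpace A]
    [MeasurableSpace A] (μ : Measure (M → A)) : IsHarmonicallyMixing μ := by
  refine fun ε _ => ⟨1, one_pos, fun χ hχ => absurd hχ (not_lt.2 ?_)⟩
  exact Set.encard_le_one_iff.2 fun a b _ _ => Subsingleton.elim a b

end CayleyGraph

/-! ### Branches of the free monoid -/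

section FreeMonoid

variable {ι : Type*}

open Classical in
/-- The generator by which `x` continues the word `v`, if it does. -/
noncomputable def FreeMonoid.branch (v x : FreeMonoid ι) : Option ι :=
  if v.toList <+: x.toList then (x.toList.drop v.toList.length).head? else none

/-- Appending a letter can create the prefix `v` only by producing `v` itself, and it does not
affect the first letter after `v` once there is one. -/
theorem FreeMonoid.branch_mul_of {v x : FreeMonoid ι} {i : ι} (hx : x ≠ v)
    (hxi : x * of i ≠ v) : branch v x = branch v (x * of i) := by
  have hxi' : x.toList ++ [i] ≠ v.toList := fun h => hxi (toList.injective (by simpa using h))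
  have hx' : x.toList ≠ v.toList := fun h => hx (toList.injective h)
  have hiff : v.toList <+: (x * of i).toList ↔ v.toList <+: x.toList := by
    rw [toList_mul, toList_of, List.prefix_concat_iff]
    simp [hxi'.symm]
  by_cases h : v.toList <+: x.toList
  · rw [branch, branch, if_pos h, if_pos (hiff.2 h)]
    obtain ⟨l, hl⟩ := h
    rw [toList_mul, ← hl]
    cases l with
    | nil => simp at hl; exact absurd hl.symm hx'
    | cons a l => simp
  · rw [branch, branch, if_neg h, if_neg (mt hiff.1 h)]

/-- Successors of `v` are labelled by their generators; the predecessor, if any, is unique and gets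
`none`. -/
theorem FreeMonoid.branch_injOn (v : FreeMonoid ι) :
    Set.InjOn (branch v) {u | (SimpleGraph.mulCayley (Set.range of)).Adj v u} := by
  have hc : ∀ i, branch v (v * of i) = some i := by
    intro i
    simp [branch]
  have hp : ∀ u i, v = u * of i → branch v u = none := by
    rintro u i rfl
    rw [branch, if_neg]
    intro h
    simpa using h.length_le
  intro u hu w hw huw
  simp only [Set.mem_ofPred_eq, SimpleGraph.mulCayley_adj', Set.exists_range_iff] at hu hw
  obtain ⟨-, i, hi | hi⟩ := hu <;> obtain ⟨-, j, hj | hj⟩ := hw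
  · rw [← hi, ← hj, hc, hc, Option.some_inj] at huw
    rw [← hi, ← hj, huw]
  · rw [← hi, hc, hp w j hj] at huw
    cases huw
  · rw [← hj, hc, hp u i hi] at huw
    cases huw
  · have h := congrArg toList (hi.symm.trans hj)
    simp only [toList_mul, toList_of] at h
    exact toList.injective (List.append_inj_left' h rfl)

end FreeMonoid

/-! ### Branches of the free group -/

section FreeGroup

variable {ι : Type*}

open Classical in
/-- The last letter of the reduced word of `x⁻¹ * v`; it labels the component of `x` after removal
of `v` from the Cayley graph. -/
noncomputable def FreeGroup.branch (v x : FreeGroup ι) : Option (ι × Bool) :=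
  (x⁻¹ * v).toWord.getLast?

/-- Passing from `x` to `x * of i` multiplies `x⁻¹ * v` on the left by a letter, which adds or
cancels a first letter. The last letter survives as long as both words are nonempty. -/
theorem FreeGroup.branch_mul_of {v x : FreeGroup ι} {i : ι} (hx : x ≠ v)
    (hxi : x * of i ≠ v) : branch v x = branch v (x * of i) := by
  classical
  have h1 : x⁻¹ * v ≠ 1 := fun h => hx (inv_mul_eq_one.1 h)
  have h2 : (of i)⁻¹ * (x⁻¹ * v) ≠ 1 := fun h => hxi (inv_mul_eq_one.1 (by simpa [mul_assoc] using h))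
  have e : branch v (x * of i) = ((of i)⁻¹ * (x⁻¹ * v)).toWord.getLast? := by
    simp only [branch, mul_inv_rev, mul_assoc]
  rw [e]
  have e' : branch v x = (x⁻¹ * v).toWord.getLast? := by
    simp only [branch]
  rw [e']
  generalize x⁻¹ * v = z at h1 h2
  replace h1 := mt toWord_eq_nil_iff.1 h1
  replace h2 := mt toWord_eq_nil_iff.1 h2
  have hw : ((of i)⁻¹ * z).toWord = reduce ((i, false) :: z.toWord) := by
    rw [toWord_mul]
    rfl
  rw [hw] at h2 ⊢
  rw [reduce.cons, reduce_toWord] at h2 ⊢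
  generalize z.toWord = L at h1 h2
  cases L with
  | nil => exact absurd rfl h1
  | cons a L =>
    simp only at h2 ⊢
    split_ifs at h2 ⊢ with h
    · cases L with
      | nil => exact absurd rfl h2
      | cons b L => simp
    · simp

theorem FreeGroup.branch_injOn (v : FreeGroup ι) :
    Set.InjOn (branch v) {u | (SimpleGraph.mulCayley (Set.range of)).Adj v u} := by
  classical
  have hc : ∀ i, branch v (v * of i) = some (i, false) := by
    intro i
    simp [branch, invRev]
  have hp : ∀ u i, v = u * of i → branch v u = some (i, true) := by
    rintro u i rfl
    simp [branch]
  intro u hu w hw huw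
  simp only [Set.mem_ofPred_eq, SimpleGraph.mulCayley_adj', Set.exists_range_iff] at hu hw
  obtain ⟨-, i, hi | hi⟩ := hu <;> obtain ⟨-, j, hj | hj⟩ := hw
  · rw [← hi, ← hj, hc, hc, Option.some_inj, Prod.mk.injEq] at huw
    rw [← hi, ← hj, huw.1]
  · rw [← hi, hc, hp w j hj] at huw
    cases huw
  · rw [← hj, hc, hp u i hi] at huw
    cases huw
  · rw [hp u i hi, hp w j hj, Option.some_inj, Prod.mk.injEq] at huw
    rw [hi, huw.1] at hj
    exact mul_right_cancel hj

end FreeGroup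

theorem mainTheorem8 {A : Type*} [Group A] [Finite A] [TopologicalSpace A] [DiscreteTopology A]
    [MeasurableSpace A] [BorelSpace A] {ι : Type*} [Finite ι] :
    (∀ μ : Measure (FreeGroup ι → A), IsProbabilityMeasure μ → IsShiftStationary μ →
      IsMarkovRandomField (SimpleGraph.mulCayley (Set.range (FreeGroup.of (α := ι)))) μ →
      (∀ (i : ι) (a b : A), transitionMatrix μ (FreeGroup.of i) a b ≠ 0) →
      IsHarmonicallyMixing μ) ∧
    (∀ μ : Measure (FreeMonoid ι → A), IsProbabilityMeasure μ → IsShiftStationary μ →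
      IsMarkovRandomField (SimpleGraph.mulCayley (Set.range (FreeMonoid.of (α := ι)))) μ →
      (∀ (i : ι) (a b : A), transitionMatrix μ (FreeMonoid.of i) a b ≠ 0) →
      IsHarmonicallyMixing μ) := by
  constructor
  · intro μ _ hst hμ hpos
    rcases isEmpty_or_nonempty ι with _ | _
    · exact isHarmonicallyMixing_of_subsingleton μ
    · exact isHarmonicallyMixing_of_mulCayley hst hμ hpos
        (FreeGroup.lift fun _ => Multiplicative.ofAdd 1) (fun i => by simp) FreeGroup.branch
        (fun _ _ _ => FreeGroup.branch_mul_of) FreeGroup.branch_injOn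
  · intro μ _ hst hμ hpos
    rcases isEmpty_or_nonempty ι with _ | _
    · have : Subsingleton (FreeMonoid ι) := inferInstanceAs (Subsingleton (List ι))
      exact isHarmonicallyMixing_of_subsingleton μ
    · exact isHarmonicallyMixing_of_mulCayley hst hμ hpos
        (FreeMonoid.lift fun _ => Multiplicative.ofAdd 1) (fun i => by simp) FreeMonoid.branch
        (fun _ _ _ => FreeMonoid.branch_mul_of) FreeMonoid.branch_injOn
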